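/- Let $D$ be a positive integer. For a real number $a$ and an integer $n\ge 0$ put $(a)_n=a(a+1)\cdots(a+n-1)$. Then for all integers $i,j$ with $0\le i,j\le D$, the hypergeometric series $${}_4F_3\!\left[\begin{array}{c}-i,\; i+1,\; -j,\; j+1\\ 1,\; D+2,\; -D\end{array};1\right]=\sum_{n=0}^{\infty}\frac{(-i)_n\,(i+1)_n\,(-j)_n\,(j+1)_n}{(1)_n\,(D+2)_n\,(-D)_n}\,\frac{1}{n!},$$ which terminates (the terms with $n>\min(i,j)$ are read as $0$), satisfies $$\left|{}_4F_3\!\left[\begin{array}{c}-i,\; i+1,\; -j,\; j+1\\ 1,\; D+2,\; -D\end{array};1\right]\right|\le 1 .$$ Equivalently, let $$c_i=\frac{3(D-i+1)\,i\,(D+i+1)}{D(D+2)(2i+1)}\ (1\le i\le D),\qquad a_i=\frac{3i(i+1)}{D(D+2)}\ (0\le i\le D),$$ $$b_i=\frac{3(D-i)(i+1)(D+i+2)}{D(D+2)(2i+1)}\ (0\le i\le D-1),\qquad \theta_i=3-2a_i\ (0\le i\le D),$$ and let $u_0,\dots,u_D\in\mathbb R[\lambda]$ be the polynomials determined by $u_0=1$,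 $u_1=\lambda/3$ and $$\lambda u_i=b_iu_{i+1}+a_iu_i+c_iu_{i-1}\qquad(1\le i\le D-1).$$ Then for all integers $0\le i,j\le D$, $$u_i(\theta_j)={}_4F_3\!\left[\begin{array}{c}-i,\; i+1,\; -j,\; j+1\\ 1,\; D+2,\; -D\end{array};1\right]\qquad\text{and}\qquad |u_i(\theta_j)|\le 1 .$$ -/

import Mathlib

open Polynomial

namespace KreschTamvakis

noncomputable section

/-- The shifted factorial `(a)_n = a (a + 1) ⋯ (a + n - 1)` of a real number `a`. -/
def poch (a : ℝ) (n : ℕ) : ℝ := (ascPochhammer ℝ n).eval a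

theorem poch_eq_prod (a : ℝ) (n : ℕ) : poch a n = ∏ k ∈ Finset.range n, (a + k) := by
  unfold poch
  induction n with
  | zero => simp
  | succ n ih => rw [ascPochhammer_succ_eval, ih, Finset.prod_range_succ]

/-- The `n`-th term of the hypergeometric series `₄F₃[a₁, a₂, a₃, a₄; b₁, b₂, b₃; z]`.
In a terminating series with a nonpositive integer among the lower parameters, the terms `0 / 0`
that occur after termination are `0`, by Lean's convention for division. -/
def hyp4F3Term (a₁ a₂ a₃ a₄ b₁ b₂ b₃ z : ℝ) (n : ℕ) : ℝ :=
  (poch a₁ n * poch a₂ n * poch a₃ n * poch a₄ n) / (poch b₁ n * poch b₂ n * poch b₃ n)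
    * (z ^ n / (n.factorial : ℝ))

/-- The hypergeometric series `₄F₃[a₁, a₂, a₃, a₄; b₁, b₂, b₃; z]`. -/
def hyp4F3 (a₁ a₂ a₃ a₄ b₁ b₂ b₃ z : ℝ) : ℝ :=
  ∑' n : ℕ, hyp4F3Term a₁ a₂ a₃ a₄ b₁ b₂ b₃ z n

/-- `c_i = 3 (D - i + 1) i (D + i + 1) / (D (D + 2) (2 i + 1))`, used for `1 ≤ i ≤ D`. -/
def coeffC (D i : ℕ) : ℝ :=
  3 * ((D : ℝ) - i + 1) * i * ((D : ℝ) + i + 1) / ((D : ℝ) * ((D : ℝ) + 2) * (2 * (i : ℝ) + 1))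

/-- `a_i = 3 i (i + 1) / (D (D + 2))`, used for `0 ≤ i ≤ D`. -/
def coeffA (D i : ℕ) : ℝ :=
  3 * (i : ℝ) * ((i : ℝ) + 1) / ((D : ℝ) * ((D : ℝ) + 2))

/-- `b_i = 3 (D - i) (i + 1) (D + i + 2) / (D (D + 2) (2 i + 1))`, used for `0 ≤ i ≤ D - 1`. -/
def coeffB (D i : ℕ) : ℝ :=
  3 * ((D : ℝ) - i) * ((i : ℝ) + 1) * ((D : ℝ) + i + 2)
    / ((D : ℝ) * ((D : ℝ) + 2) * (2 * (i : ℝ) + 1))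

/-- `θ_i = 3 - 2 a_i`, used for `0 ≤ i ≤ D`. -/
def theta (D i : ℕ) : ℝ := 3 - 2 * coeffA D i

/-- The polynomials `u_0, …, u_D`, given by `u_0 = 1`, `u_1 = λ / 3` and the three-term recurrence
`λ u_i = b_i u_{i+1} + a_i u_i + c_i u_{i-1}` for `1 ≤ i ≤ D - 1`, solved for `u_{i+1}`.
Only the indices `i ≤ D` are meaningful. -/
def racahU (D : ℕ) : ℕ → ℝ[X]
  | 0 => 1
  | 1 => C (1 / 3) * X
  | i + 2 => C (1 / coeffB D (i + 1)) *
      ((X - C (coeffA D (i + 1))) * racahU D (i + 1) - C (coeffC D (i + 1)) * racahU D i)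

theorem coeffB_ne_zero {D i : ℕ} (h : i < D) : coeffB D i ≠ 0 := by
  have hD : (0 : ℝ) < D := by exact_mod_cast (Nat.zero_le i).trans_lt h
  have hi : (0 : ℝ) < (D : ℝ) - i := sub_pos.mpr (by exact_mod_cast h)
  unfold coeffB
  positivity

/-- The polynomials `racahU D i` satisfy the recurrence that defines them. -/
theorem racahU_recurrence {D i : ℕ} (h1 : 1 ≤ i) (h2 : i ≤ D - 1) :
    X * racahU D i = C (coeffB D i) * racahU D (i + 1) + C (coeffA D i) * racahU D i
      + C (coeffC D i) * racahU D (i - 1) := by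
  obtain ⟨k, rfl⟩ : ∃ k, i = k + 1 := ⟨i - 1, by omega⟩
  have hb : coeffB D (k + 1) ≠ 0 := coeffB_ne_zero (by omega)
  have hc : (C (coeffB D (k + 1)) : ℝ[X]) * C (1 / coeffB D (k + 1)) = 1 := by
    rw [← C_mul, mul_one_div_cancel hb, C_1]
  have e : racahU D (k + 1 + 1) = C (1 / coeffB D (k + 1)) *
      ((X - C (coeffA D (k + 1))) * racahU D (k + 1) - C (coeffC D (k + 1)) * racahU D k) := by
    rw [racahU]
  rw [e, ← mul_assoc, hc, Nat.add_sub_cancel]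
  ring

end

end KreschTamvakis

/-!
Why the bound holds: up to a positive factor, `u_i(θ_j)` is an eigenvalue of a completely positive
map that multiplies the identity by that same factor.

Let `V` be the irreducible `sl₂`-representation of dimension `D + 1`, with operators `E`, `F = Eᵀ`,
`H` in an orthonormal weight basis. Under the adjoint action `End V` is the sum of one irreducible
component of each spin `i = 0, …, D`, with highest weight vector `E ^ i`. Take a weight basis
`Sₖ = (ad F)ᵏ (E ^ j)`, `0 ≤ k ≤ 2 j`, of the spin-`j` component, and with weights `wₖ` inverse to
the square norms put `Φ_j(X) = ∑ₖ wₖ Sₖ X Sₖᵀ` (`covariantMap`).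

* `Φ_j` commutes with the adjoint action (`raising_lie_covariantMap` and its consequences), so by
  Schur's lemma, in the form `exists_eq_smul_raising_pow`, `Φ_j(E ^ i) = l_i E ^ i` for scalars
  `l_i`.
* The Casimir eigenvalue of the spin-`j` component gives the identity
  `2 E Φ_j(F X) + 2 F Φ_j(E X) + H Φ_j(H X) = (D (D + 2) - 2 j (j + 1)) Φ_j(X)`
  (`casimir_covariantMap`). For `X = E ^ i`, the products `F X` and `H X` have components of spins
  `i - 1`, `i`, `i + 1` only, and the identity becomes the three-term recurrence of the `u_i` at
  `θ_j`. Hence `l_i = l_0 u_i(θ_j)` (`covariantMap_eigenvalue_eq`).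
* Here `Φ_j(1) = l_0` with `l_0 > 0`, and a completely positive map attains its operator norm at
  `1`, so that `|l_i| ≤ l_0` (`abs_le_of_kraus_eigenvector`).

The hypergeometric series satisfies the same recurrence in `i`, because the difference of the two
sides telescopes (`hypSum_recurrence`); so it equals `u_i(θ_j)` as well.
-/

namespace KreschTamvakis

noncomputable section

/-! ### The three-term recurrence -/

/-- A solution of the three-term recurrence at `t` is determined by its initial value. -/
theorem racahU_eval_unique {D : ℕ} {t s : ℝ} {v : ℕ → ℝ} (h0 : v 0 = s) (h1 : v 1 = s * (t / 3))
    (h : ∀ i, i + 2 ≤ D →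
      t * v (i + 1) = coeffB D (i + 1) * v (i + 2) + coeffA D (i + 1) * v (i + 1)
        + coeffC D (i + 1) * v i) :
    ∀ i, i ≤ D → v i = s * (racahU D i).eval t
  | 0, _ => by simp [racahU, h0]
  | 1, _ => by
    simp only [racahU, eval_mul, eval_C, eval_X, h1]
    ring
  | i + 2, hi => by
    have hb : coeffB D (i + 1) ≠ 0 := coeffB_ne_zero (by omega)
    have e0 := racahU_eval_unique h0 h1 h i (by omega)
    have e1 := racahU_eval_unique h0 h1 h (i + 1) (by omega)
    have e2 := h i hi
    rw [e0, e1] at e2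
    simp only [racahU, eval_mul, eval_sub, eval_C, eval_X]
    field_simp
    linear_combination -e2

/-! ### The hypergeometric sum -/

theorem poch_zero (a : ℝ) : poch a 0 = 1 := by simp [poch]

theorem poch_succ (a : ℝ) (n : ℕ) : poch a (n + 1) = poch a n * (a + n) := by
  simp [poch, ascPochhammer_succ_eval]

theorem poch_succ_left (a : ℝ) (n : ℕ) : poch a (n + 1) = a * poch (a + 1) n := by
  simp [poch, ascPochhammer_succ_left]

theorem poch_neg_eq_zero {j n : ℕ} (h : j < n) : poch (-(j : ℝ)) n = 0 := by
  rw [poch_eq_prod]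
  exact Finset.prod_eq_zero (Finset.mem_range.mpr h) (by simp)

theorem poch_pos {a : ℝ} (ha : 0 < a) (n : ℕ) : 0 < poch a n := by
  rw [poch_eq_prod]
  exact Finset.prod_pos fun k _ => by positivity

theorem poch_neg_ne_zero {D n : ℕ} (h : n ≤ D) : poch (-(D : ℝ)) n ≠ 0 := by
  rw [poch_eq_prod]
  refine Finset.prod_ne_zero_iff.mpr fun k hk => ?_
  have : (k : ℝ) < D := by exact_mod_cast (Finset.mem_range.mp hk).trans_le h
  linarith

/-- The polynomial `(-x)_n (x + 1)_n`, of degree `n` in `x (x + 1)`. -/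
def pochPair (n : ℕ) (x : ℝ) : ℝ := poch (-x) n * poch (x + 1) n

theorem pochPair_succ (n : ℕ) (x : ℝ) :
    pochPair (n + 1) x = -((x - n) * (x + n + 1)) * pochPair n x := by
  simp only [pochPair, poch_succ]; ring

/-- Together with `pochPair_succ` and `pochPair_succ_sub_one`: the values at `x - 1`, `x` and `x + 1`
are multiples of one common polynomial, which reduces the recurrence to an identity of rational
functions. -/
theorem pochPair_succ_add_one (n : ℕ) (x : ℝ) :
    pochPair (n + 1) (x + 1) = -((x + n + 1) * (x + n + 2)) * pochPair n x := by
  have h1 : poch (-(x + 1)) (n + 1) = -(x + 1) * poch (-x) n := by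
    rw [poch_succ_left]; ring_nf
  have h2 : (x + 1) * poch (x + 1 + 1) (n + 1) = poch (x + 1) n * (x + 1 + n) * (x + 2 + n) := by
    rw [← poch_succ_left, poch_succ, poch_succ]; push_cast; ring
  simp only [pochPair, h1]
  linear_combination -poch (-x) n * h2

theorem pochPair_neg_one_sub (n : ℕ) (x : ℝ) : pochPair n (-1 - x) = pochPair n x := by
  simp only [pochPair]
  ring_nf

theorem pochPair_succ_sub_one (n : ℕ) (x : ℝ) :
    pochPair (n + 1) (x - 1) = -((x - n) * (x - n - 1)) * pochPair n x := by
  have h := pochPair_succ_add_one n (-1 - x)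
  rw [pochPair_neg_one_sub, ← pochPair_neg_one_sub (n + 1),
    show -1 - (-1 - x + 1) = x - 1 by ring] at h
  rw [h]; ring

theorem pochPair_eq_zero {j n : ℕ} (h : j < n) : pochPair n j = 0 := by
  rw [pochPair, poch_neg_eq_zero h, zero_mul]

/-- The factor of the `n`-th term of the hypergeometric series that does not depend on `i`. -/
def dualFactor (D j n : ℕ) : ℝ :=
  pochPair n j / (poch 1 n * poch (D + 2) n * poch (-(D : ℝ)) n * n.factorial)

theorem hyp4F3Term_eq (D j n : ℕ) (x : ℝ) :
    hyp4F3Term (-x) (x + 1) (-(j : ℝ)) (j + 1) 1 (D + 2) (-(D : ℝ)) 1 n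
      = pochPair n x * dualFactor D j n := by
  simp only [hyp4F3Term, pochPair, dualFactor, one_pow, div_eq_mul_inv, mul_inv]
  ring

theorem dualFactor_eq_zero {D j n : ℕ} (h : j < n) : dualFactor D j n = 0 := by
  rw [dualFactor, pochPair_eq_zero h, zero_div]

/-- The ratio of consecutive dual factors, cleared of denominators so that it holds for all `n`. -/
theorem dualFactor_succ {D j : ℕ} (hj : j ≤ D) (n : ℕ) :
    ((n : ℝ) + 1) ^ 2 * (D + 2 + n) * (n - D) * dualFactor D j (n + 1)
      = (n * (n + 1) - j * (j + 1)) * dualFactor D j n := by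
  rcases lt_trichotomy n D with h | rfl | h
  · have h1 := (poch_pos one_pos n).ne'
    have h2 := (poch_pos (show (0 : ℝ) < D + 2 by positivity) n).ne'
    have h3 := poch_neg_ne_zero h.le
    have h4 : (n.factorial : ℝ) ≠ 0 := by exact_mod_cast n.factorial_ne_zero
    have h5 : (n : ℝ) - D ≠ 0 := sub_ne_zero.mpr (by exact_mod_cast h.ne)
    have h6 : -(D : ℝ) + n ≠ 0 := by rwa [neg_add_eq_sub]
    have h7 : (D : ℝ) + 2 + n ≠ 0 := by positivity
    have h8 : (1 : ℝ) + n ≠ 0 := by positivity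
    simp only [dualFactor, pochPair_succ, poch_succ, Nat.factorial_succ, Nat.cast_mul,
      Nat.cast_add, Nat.cast_one]
    field_simp
    ring
  -- At `n = D` the next factor is a junk `0 / 0`, but its coefficient `n - D` vanishes.
  · rcases hj.eq_or_lt with rfl | h
    · simp
    · simp [dualFactor_eq_zero h]
  · rw [dualFactor_eq_zero (hj.trans_lt h), dualFactor_eq_zero (by omega)]; simp

/-- The terminating hypergeometric sum, as a function of a real parameter in place of `i`. -/
def hypSum (D j : ℕ) (x : ℝ) : ℝ := ∑ n ∈ Finset.range (D + 1), pochPair n x * dualFactor D j n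

theorem hasSum_hyp4F3Term {D j : ℕ} (hj : j ≤ D) (x : ℝ) :
    HasSum (hyp4F3Term (-x) (x + 1) (-(j : ℝ)) (j + 1) 1 (D + 2) (-(D : ℝ)) 1)
      (hypSum D j x) := by
  have h : hypSum D j x = ∑ n ∈ Finset.range (D + 1),
      hyp4F3Term (-x) (x + 1) (-(j : ℝ)) (j + 1) 1 (D + 2) (-(D : ℝ)) 1 n :=
    Finset.sum_congr rfl fun n _ => (hyp4F3Term_eq D j n x).symm
  rw [h]
  refine hasSum_sum_of_ne_finset_zero fun n hn => ?_
  rw [hyp4F3Term_eq, dualFactor_eq_zero (by simp at hn; omega), mul_zero]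

theorem hypSum_zero (D j : ℕ) : hypSum D j 0 = 1 := by
  rw [hypSum, Finset.sum_eq_single 0]
  · simp [pochPair, dualFactor, poch_zero]
  · intro n _ hn
    have := pochPair_eq_zero (Nat.pos_of_ne_zero hn)
    rw [Nat.cast_zero] at this
    rw [this, zero_mul]
  · simp

/-- The hypergeometric sum satisfies the recurrence of the `u_i`; at `i = 0` the coefficient of the
meaningless value at `-1` vanishes. The summands of the difference between the two sides of the recurrence telescope. -/
theorem hypSum_recurrence {D j : ℕ} (hD : 0 < D) (hj : j ≤ D) (i : ℕ) :
    theta D j * hypSum D j i = coeffB D i * hypSum D j (i + 1) + coeffA D i * hypSum D j i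
      + coeffC D i * hypSum D j (i - 1) := by
  have hD' : (0 : ℝ) < D := by exact_mod_cast hD
  let g : ℕ → ℝ := fun n =>
    n ^ 2 * (D + 1 + n) * (n - 1 - D) * dualFactor D j n * pochPair (n - 1) i
  have key : ∀ n, coeffB D i * (pochPair n (i + 1) * dualFactor D j n)
      + coeffA D i * (pochPair n i * dualFactor D j n)
      + coeffC D i * (pochPair n (i - 1) * dualFactor D j n)
      - theta D j * (pochPair n i * dualFactor D j n)
      = -6 / (D * (D + 2)) * (g (n + 1) - g n) := by
    intro n
    have h := dualFactor_succ hj n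
    have hg : g (n + 1) = (n * (n + 1) - j * (j + 1)) * dualFactor D j n * pochPair n i := by
      simp only [g, Nat.add_sub_cancel, ← h]; push_cast; ring
    rw [hg]
    simp only [g, coeffA, coeffB, coeffC, theta]
    rcases n with _ | n
    · simp only [pochPair, poch_zero, Nat.cast_zero]
      field_simp
      ring
    · rw [pochPair_succ_add_one, pochPair_succ_sub_one, pochPair_succ, Nat.add_sub_cancel]
      push_cast
      field_simp
      ring
  have hs := Finset.sum_congr (rfl : Finset.range (D + 1) = _) fun n _ => key n
  rw [← Finset.mul_sum, Finset.sum_range_sub] at hs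
  have g0 : g 0 = 0 := by simp [g]
  have g1 : g (D + 1) = 0 := by simp [g]
  rw [g0, g1] at hs
  simp only [Finset.sum_sub_distrib, Finset.sum_add_distrib, ← Finset.mul_sum] at hs
  simp only [hypSum]
  linear_combination -hs

theorem racahU_eval_theta_eq_hypSum {D i j : ℕ} (hD : 0 < D) (hi : i ≤ D) (hj : j ≤ D) :
    (racahU D i).eval (theta D j) = hypSum D j i := by
  have hD' : (0 : ℝ) < D := by exact_mod_cast hD
  have h1 : hypSum D j 1 = 1 * (theta D j / 3) := by
    -- At `i = 0` the recurrence reads `θ_j = 3 u_1`.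
    have h := hypSum_recurrence hD hj 0
    simp only [coeffA, coeffB, coeffC, Nat.cast_zero, hypSum_zero, zero_add, mul_zero, zero_mul,
      zero_div, sub_zero, add_zero, mul_one] at h
    rw [h]
    field_simp
  refine Eq.symm <| (racahU_eval_unique (s := 1) (v := fun i => hypSum D j i)
    (by simp [hypSum_zero]) (by simpa using h1) (fun i _ => ?_) i hi).trans (one_mul _)
  have h := hypSum_recurrence hD hj (i + 1)
  push_cast at h ⊢
  rw [add_sub_cancel_right] at h
  rw [h]
  ring_nf

/-! ### Eigenvalues of completely positive maps -/

section Contraction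

variable {V ι : Type*} [NormedAddCommGroup V] [InnerProductSpace ℝ V] [CompleteSpace V]

open ContinuousLinearMap in
/-- A completely positive map `X ↦ ∑ wₖ Sₖ X Sₖ*` that sends `1` to `c` has operator norm at most
`c`; hence so are its eigenvalues. The estimate is the Cauchy–Schwarz inequality, used once in `V`
and once for the sum over `k`. -/
theorem abs_le_of_kraus_eigenvector (s : Finset ι) (w : ι → ℝ) (hw : ∀ k ∈ s, 0 ≤ w k)
    (S : ι → V →L[ℝ] V) (X : V →L[ℝ] V) (hX : X ≠ 0) {c μ : ℝ} (hc : 0 ≤ c)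
    (h1 : ∑ k ∈ s, w k • (S k * adjoint (S k)) = c • 1)
    (h2 : ∑ k ∈ s, w k • (S k * X * adjoint (S k)) = μ • X) : |μ| ≤ c := by
  have hadj : ∀ k (a : V), inner ℝ a (S k (adjoint (S k) a)) = ‖adjoint (S k) a‖ ^ 2 :=
    fun k a => by rw [← adjoint_inner_left, real_inner_self_eq_norm_sq]
  have hsq : ∀ a : V, ∑ k ∈ s, w k * ‖adjoint (S k) a‖ ^ 2 = c * ‖a‖ ^ 2 := by
    intro a
    have h := congrArg (fun T : V →L[ℝ] V => inner ℝ a (T a)) h1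
    simpa only [sum_apply, smul_apply, mul_def, comp_apply, one_apply_eq_self, inner_sum,
      inner_smul_right, real_inner_self_eq_norm_sq, hadj] using h
  have hbound : ∀ b : V, ‖(μ • X) b‖ ≤ c * ‖X‖ * ‖b‖ := by
    intro b
    set a := (μ • X) b with ha
    have haa : ‖a‖ ^ 2 ≤ ‖X‖ * ∑ k ∈ s, w k * (‖adjoint (S k) a‖ * ‖adjoint (S k) b‖) := by
      have h : a = (∑ k ∈ s, w k • (S k * X * adjoint (S k))) b := by rw [h2]
      rw [← real_inner_self_eq_norm_sq]
      nth_rw 2 [h]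
      simp only [sum_apply, smul_apply, mul_def, comp_apply, inner_sum, inner_smul_right,
        Finset.mul_sum]
      refine Finset.sum_le_sum fun k hk => ?_
      rw [← adjoint_inner_left]
      calc w k * inner ℝ (adjoint (S k) a) (X (adjoint (S k) b))
          ≤ w k * (‖adjoint (S k) a‖ * (‖X‖ * ‖adjoint (S k) b‖)) := by
            refine mul_le_mul_of_nonneg_left ((real_inner_le_norm _ _).trans ?_) (hw k hk)
            gcongr
            exact X.le_opNorm _
        _ = _ := by ring
    have hcs : (∑ k ∈ s, w k * (‖adjoint (S k) a‖ * ‖adjoint (S k) b‖)) ^ 2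
        ≤ (c * ‖a‖ * ‖b‖) ^ 2 := by
      refine (Finset.sum_sq_le_sum_mul_sum_of_sq_le_mul s
        (f := fun k => w k * ‖adjoint (S k) a‖ ^ 2) (g := fun k => w k * ‖adjoint (S k) b‖ ^ 2)
        (fun k hk => mul_nonneg (hw k hk) (by positivity))
        (fun k hk => mul_nonneg (hw k hk) (by positivity)) fun k _ => le_of_eq (by ring)).trans_eq ?_
      rw [hsq, hsq]; ring
    have hle := (abs_le_of_sq_le_sq' hcs (by positivity)).2
    rcases (norm_nonneg a).eq_or_lt with h0 | h0
    · rw [← h0]; positivity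
    · refine le_of_mul_le_mul_left ?_ h0
      calc ‖a‖ * ‖a‖ = ‖a‖ ^ 2 := by ring
        _ ≤ _ := haa.trans (mul_le_mul_of_nonneg_left hle (norm_nonneg X))
        _ = _ := by ring
  have h := opNorm_le_bound _ (by positivity) hbound
  rw [norm_smul, Real.norm_eq_abs] at h
  exact le_of_mul_le_mul_right h (norm_pos_iff.mpr hX)

end Contraction

open Matrix in
theorem abs_le_of_kraus_eigenmatrix {m ι : Type*} [Fintype m] [DecidableEq m] (s : Finset ι)
    (w : ι → ℝ) (hw : ∀ k ∈ s, 0 ≤ w k) (S : ι → Matrix m m ℝ) (X : Matrix m m ℝ) (hX : X ≠ 0)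
    {c μ : ℝ} (hc : 0 ≤ c) (h1 : ∑ k ∈ s, w k • (S k * (S k)ᵀ) = c • 1)
    (h2 : ∑ k ∈ s, w k • (S k * X * (S k)ᵀ) = μ • X) : |μ| ≤ c := by
  let T := toEuclideanCLM (n := m) (𝕜 := ℝ)
  have hT : ∀ A : Matrix m m ℝ, T Aᵀ = ContinuousLinearMap.adjoint (T A) := fun A => by
    rw [← conjTranspose_eq_transpose_of_trivial]
    exact map_star T A
  have hS : ∀ (r : ℝ) (A : Matrix m m ℝ), T (r • A) = r • T A := fun r A => map_smul T r A
  refine abs_le_of_kraus_eigenvector s w hw (fun k => T (S k)) (T X)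
    ((map_ne_zero_iff T T.injective).mpr hX) hc ?_ ?_
  · simp only [← hT, ← map_mul, ← hS, ← map_sum, h1]
    rw [hS, map_one]
  · simp only [← hT, ← map_mul, ← hS, ← map_sum, h2]

/-! ### The irreducible representation of dimension `D + 1` -/

/-- The raising operator of the irreducible `sl₂`-representation of dimension `D + 1`, in an
orthonormal weight basis; column `y` holds the image of the `y`-th basis vector. -/
def raising (D : ℕ) : Matrix (Fin (D + 1)) (Fin (D + 1)) ℝ :=
  Matrix.of fun x y => if (x : ℕ) = y + 1 then √(((y : ℝ) + 1) * (D - y)) else 0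

/-- The lowering operator, adjoint to `raising D`. -/
def lowering (D : ℕ) : Matrix (Fin (D + 1)) (Fin (D + 1)) ℝ := (raising D).transpose

/-- The weight operator, with eigenvalues `-D, -D + 2, …, D`. -/
def weightOp (D : ℕ) : Matrix (Fin (D + 1)) (Fin (D + 1)) ℝ :=
  Matrix.diagonal fun x => 2 * (x : ℝ) - D

variable {D : ℕ}

-- The bracket of two matrices is their commutator.
attribute [local instance] LieRing.ofAssociativeRing

theorem raising_mul_apply_succ (Y : Matrix (Fin (D + 1)) (Fin (D + 1)) ℝ) (x : Fin D)
    (y : Fin (D + 1)) :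
    (raising D * Y) x.succ y = √(((x : ℝ) + 1) * (D - x)) * Y x.castSucc y := by
  rw [Matrix.mul_apply, Finset.sum_eq_single x.castSucc]
  · simp [raising]
  · intro z _ hz
    have : ¬ (x : ℕ) = z := fun h => hz (Fin.ext h.symm)
    simp [raising, this]
  · simp

theorem raising_mul_apply_zero (Y : Matrix (Fin (D + 1)) (Fin (D + 1)) ℝ) (y : Fin (D + 1)) :
    (raising D * Y) 0 y = 0 := by
  rw [Matrix.mul_apply]
  exact Finset.sum_eq_zero fun z _ => by simp [raising]

theorem mul_raising_apply_castSucc (Y : Matrix (Fin (D + 1)) (Fin (D + 1)) ℝ)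
    (x : Fin (D + 1)) (y : Fin D) :
    (Y * raising D) x y.castSucc = Y x y.succ * √(((y : ℝ) + 1) * (D - y)) := by
  rw [Matrix.mul_apply, Finset.sum_eq_single y.succ]
  · simp [raising]
  · intro z _ hz
    have : ¬ (z : ℕ) = y + 1 := fun h => hz (Fin.ext (by simpa using h))
    simp [raising, this]
  · simp

theorem raising_coeff_pos (x : Fin D) : 0 < ((x : ℝ) + 1) * (D - x) := by
  have : (x : ℝ) < D := by exact_mod_cast x.2
  exact mul_pos (by positivity) (sub_pos.mpr this)

theorem raising_mul_lowering :
    raising D * lowering D = Matrix.diagonal fun x : Fin (D + 1) => (x : ℝ) * (D + 1 - x) := by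
  ext x z
  refine Fin.cases ?_ (fun x => ?_) x
  · rw [raising_mul_apply_zero]
    simp [Matrix.diagonal_apply]
  · rw [raising_mul_apply_succ, lowering, Matrix.transpose_apply, Matrix.diagonal_apply]
    simp only [raising, Matrix.of_apply, Fin.val_castSucc, Fin.ext_iff, Fin.val_succ,
      eq_comm (a := (z : ℕ))]
    split_ifs
    · rw [Real.mul_self_sqrt (raising_coeff_pos x).le]
      push_cast
      ring
    · simp

theorem lowering_mul_raising :
    lowering D * raising D = Matrix.diagonal fun x : Fin (D + 1) => ((x : ℝ) + 1) * (D - x) := by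
  ext x z
  refine Fin.lastCases ?_ (fun z => ?_) z
  · have h : ∀ y : Fin (D + 1), raising D y (Fin.last D) = 0 := fun y => by
      have := y.2
      simp [raising]
    rw [Matrix.mul_apply, Finset.sum_eq_zero fun y _ => by rw [h, mul_zero], Matrix.diagonal_apply]
    split_ifs with hx
    · simp [hx]
    · rfl
  · rw [mul_raising_apply_castSucc, lowering, Matrix.transpose_apply, Matrix.diagonal_apply]
    simp only [raising, Matrix.of_apply, Fin.val_castSucc, Fin.ext_iff, Fin.val_succ,
      Nat.add_right_cancel_iff, eq_comm (a := (z : ℕ))]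
    split_ifs with hx
    · rw [hx, Real.mul_self_sqrt (raising_coeff_pos z).le]
    · simp

theorem raising_lie_lowering : ⁅raising D, lowering D⁆ = weightOp D := by
  rw [Ring.lie_def, raising_mul_lowering, lowering_mul_raising, Matrix.diagonal_sub, weightOp]
  congr 1
  ext x
  ring

theorem weightOp_lie_raising : ⁅weightOp D, raising D⁆ = 2 • raising D := by
  ext x y
  rw [Ring.lie_def, weightOp, Matrix.sub_apply, Matrix.diagonal_mul, Matrix.mul_diagonal,
    Matrix.smul_apply]
  simp only [raising, Matrix.of_apply]
  split_ifs with h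
  · rw [h]
    push_cast
    rw [nsmul_eq_mul]
    push_cast
    ring
  · simp

theorem transpose_weightOp : (weightOp D).transpose = weightOp D := Matrix.diagonal_transpose _

theorem weightOp_lie_lowering : ⁅weightOp D, lowering D⁆ = -(2 • lowering D) := by
  have h := congrArg Matrix.transpose (weightOp_lie_raising (D := D))
  rw [Ring.lie_def, Matrix.transpose_sub, Matrix.transpose_mul, Matrix.transpose_mul,
    transpose_weightOp, Matrix.transpose_smul, ← lowering] at h
  rw [Ring.lie_def, ← h, neg_sub]

theorem isSl2Triple (hD : 0 < D) : IsSl2Triple (weightOp D) (raising D) (lowering D) where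
  h_ne_zero h := by
    have := congrFun₂ h 0 0
    simp [weightOp] at this
    omega
  lie_e_f := raising_lie_lowering
  lie_h_e_nsmul := weightOp_lie_raising
  lie_h_f_nsmul := weightOp_lie_lowering

/-- The Casimir operator `4 F E + 2 H + H ^ 2` acts as the scalar `D (D + 2)`. -/
theorem lowering_mul_raising_eq :
    lowering D * raising D = (1 / 4 : ℝ) • (((D : ℝ) * (D + 2)) • (1 : Matrix _ _ ℝ)
      - (2 : ℝ) • weightOp D - weightOp D * weightOp D) := by
  rw [lowering_mul_raising, weightOp, Matrix.diagonal_mul_diagonal, ← Matrix.diagonal_one,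
    ← Matrix.diagonal_smul, ← Matrix.diagonal_smul, Matrix.diagonal_sub, Matrix.diagonal_sub,
    ← Matrix.diagonal_smul]
  congr 1
  ext x
  simp only [Pi.smul_apply, smul_eq_mul, mul_one]
  ring

theorem lie_raising_pow (i : ℕ) : ⁅raising D, raising D ^ i⁆ = 0 := by
  rw [Ring.lie_def, ← pow_succ, ← pow_succ', sub_self]

theorem weightOp_mul_raising : weightOp D * raising D
    = raising D * weightOp D + (2 : ℝ) • raising D := by
  have h := weightOp_lie_raising (D := D)
  rw [Ring.lie_def, sub_eq_iff_eq_add'] at h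
  rw [h]
  module

theorem weightOp_lie_raising_pow (i : ℕ) :
    ⁅weightOp D, raising D ^ i⁆ = (2 * i : ℝ) • raising D ^ i := by
  induction i with
  | zero => simp [Ring.lie_def]
  | succ i ih =>
    rw [Ring.lie_def, sub_eq_iff_eq_add'] at ih ⊢
    rw [pow_succ, ← mul_assoc, ih, add_mul, mul_assoc, weightOp_mul_raising]
    simp only [mul_add, mul_assoc, smul_mul_assoc, mul_smul_comm]
    push_cast
    module

theorem raising_pow_apply_pos {i : ℕ} (hi : i ≤ D) :
    0 < (raising D ^ i) ⟨i, Nat.lt_succ_of_le hi⟩ 0 := by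
  induction i with
  | zero => exact zero_lt_one
  | succ i ih =>
    have h := raising_mul_apply_succ (raising D ^ i) (⟨i, hi⟩ : Fin D) 0
    rw [← pow_succ'] at h
    exact h.symm ▸ mul_pos (Real.sqrt_pos.mpr (raising_coeff_pos _)) (ih (by omega))

theorem raising_pow_ne_zero {i : ℕ} (hi : i ≤ D) : raising D ^ i ≠ 0 := fun h => by
  have := raising_pow_apply_pos hi
  simp [h] at this

/-- The lowest weight vector is cyclic for `raising D`, so an operator commuting with `raising D`
is determined by its value there. -/
theorem eq_zero_of_lie_raising {Y : Matrix (Fin (D + 1)) (Fin (D + 1)) ℝ}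
    (hY : ⁅raising D, Y⁆ = 0) (h0 : ∀ x, Y x 0 = 0) : Y = 0 := by
  rw [Ring.lie_def, sub_eq_zero] at hY
  ext x y
  induction y using Fin.induction generalizing x with
  | zero => exact h0 x
  | succ y ih =>
    have h := congrFun₂ hY x y.castSucc
    rw [mul_raising_apply_castSucc, Matrix.mul_apply,
      Finset.sum_eq_zero fun z _ => by rw [ih, Matrix.zero_apply, mul_zero]] at h
    exact (mul_eq_zero.mp h.symm).resolve_right (Real.sqrt_pos.mpr (raising_coeff_pos y)).ne'

/-- A form of Schur's lemma: the highest weight vectors of weight `2 i` in the space of operators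
are the multiples of `raising D ^ i`. -/
theorem exists_eq_smul_raising_pow {Y : Matrix (Fin (D + 1)) (Fin (D + 1)) ℝ} {i : ℕ} (hi : i ≤ D)
    (hE : ⁅raising D, Y⁆ = 0) (hH : ⁅weightOp D, Y⁆ = (2 * i : ℝ) • Y) :
    ∃ a : ℝ, Y = a • raising D ^ i := by
  have hpos := raising_pow_apply_pos hi
  set p : Fin (D + 1) := ⟨i, Nat.lt_succ_of_le hi⟩
  -- The value at the lowest weight vector is a multiple of the `i`-th basis vector.
  have hsupp : ∀ Z : Matrix (Fin (D + 1)) (Fin (D + 1)) ℝ, ⁅weightOp D, Z⁆ = (2 * i : ℝ) • Z →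
      ∀ x, x ≠ p → Z x 0 = 0 := by
    intro Z hZ x hx
    have h := congrFun₂ hZ x 0
    rw [Ring.lie_def, weightOp, Matrix.sub_apply, Matrix.diagonal_mul, Matrix.mul_diagonal,
      Matrix.smul_apply, smul_eq_mul, Fin.val_zero] at h
    have hx' : (x : ℝ) - i ≠ 0 :=
      sub_ne_zero.mpr fun h => hx (Fin.ext (by exact_mod_cast h))
    refine (mul_eq_zero.mp (?_ : ((x : ℝ) - i) * Z x 0 = 0)).resolve_left hx'
    push_cast at h
    linear_combination h / 2
  refine ⟨Y p 0 / (raising D ^ i) p 0, sub_eq_zero.mp (eq_zero_of_lie_raising ?_ fun x => ?_)⟩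
  · rw [lie_sub, lie_smul, hE, lie_raising_pow, smul_zero, sub_zero]
  · rw [Matrix.sub_apply, Matrix.smul_apply, smul_eq_mul]
    rcases eq_or_ne x p with rfl | hx
    · field_simp
      ring
    · rw [hsupp Y hH x hx, hsupp _ (weightOp_lie_raising_pow i) x hx]
      ring

/-! ### The covariant completely positive map -/

/-- The weight basis of the spin-`j` component of the space of operators, from the highest weight
vector `raising D ^ j` (`k = 0`) down; it is nonzero for `k ≤ 2 j`. -/
def krausOp (D j k : ℕ) : Matrix (Fin (D + 1)) (Fin (D + 1)) ℝ :=
  (LieModule.toEnd ℝ (Matrix (Fin (D + 1)) (Fin (D + 1)) ℝ) (Matrix (Fin (D + 1)) (Fin (D + 1)) ℝ)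
    (lowering D) ^ k) (raising D ^ j)

theorem hasPrimitiveVectorWith (hD : 0 < D) {j : ℕ} (hj : j ≤ D) :
    (isSl2Triple hD).HasPrimitiveVectorWith (raising D ^ j) (2 * j : ℝ) where
  ne_zero := raising_pow_ne_zero hj
  lie_h := weightOp_lie_raising_pow j
  lie_e := lie_raising_pow j

theorem lowering_lie_krausOp (D j k : ℕ) : ⁅lowering D, krausOp D j k⁆ = krausOp D j (k + 1) := by
  simp [krausOp, pow_succ']

theorem raising_lie_krausOp_zero (D j : ℕ) : ⁅raising D, krausOp D j 0⁆ = 0 := lie_raising_pow j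

variable {j : ℕ}

theorem raising_lie_krausOp_succ (hD : 0 < D) (hj : j ≤ D) (k : ℕ) :
    ⁅raising D, krausOp D j (k + 1)⁆ = (((k : ℝ) + 1) * (2 * j - k)) • krausOp D j k :=
  (hasPrimitiveVectorWith hD hj).lie_e_pow_succ_toEnd_f k

theorem weightOp_lie_krausOp (hD : 0 < D) (hj : j ≤ D) (k : ℕ) :
    ⁅weightOp D, krausOp D j k⁆ = (2 * j - 2 * k : ℝ) • krausOp D j k :=
  (hasPrimitiveVectorWith hD hj).lie_h_pow_toEnd_f k

theorem krausOp_eq_zero (hD : 0 < D) (hj : j ≤ D) : krausOp D j (2 * j + 1) = 0 :=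
  (hasPrimitiveVectorWith hD hj).pow_toEnd_f_eq_zero_of_eq_nat (by push_cast; rfl)

theorem raising_lie_krausOp (hD : 0 < D) (hj : j ≤ D) (k : ℕ) :
    ⁅raising D, krausOp D j k⁆ = ((k : ℝ) * (2 * j - k + 1)) • krausOp D j (k - 1) := by
  rcases k with _ | k
  · simp [raising_lie_krausOp_zero]
  · rw [raising_lie_krausOp_succ hD hj, Nat.add_sub_cancel]
    push_cast
    ring_nf

/-- Up to a factor independent of `k`, the inverse of the squared Hilbert–Schmidt norm of
`krausOp D j k`, for `k ≤ 2 j`. -/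
def krausWeight (j k : ℕ) : ℝ := ((2 * j - k).factorial : ℝ) / k.factorial

theorem krausWeight_pos (j k : ℕ) : 0 < krausWeight j k := by
  unfold krausWeight; positivity

theorem krausWeight_succ {k : ℕ} (hk : k < 2 * j) :
    krausWeight j (k + 1) * (((k : ℝ) + 1) * (2 * j - k)) = krausWeight j k := by
  obtain ⟨r, hr⟩ : ∃ r, 2 * j = k + 1 + r := ⟨2 * j - (k + 1), by omega⟩
  have hr' : (2 * j : ℝ) = k + 1 + r := by exact_mod_cast hr
  have e1 : 2 * j - (k + 1) = r := by omega
  have e2 : 2 * j - k = r + 1 := by omega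
  rw [krausWeight, krausWeight, e1, e2, hr', Nat.factorial_succ, Nat.factorial_succ]
  push_cast
  field_simp
  ring

/-- The completely positive map `X ↦ ∑ₖ wₖ Sₖ X Sₖᵀ`, where `Sₖ` runs over the weight basis of
the spin-`j` operators. -/
def covariantMap (D j : ℕ) :
    Matrix (Fin (D + 1)) (Fin (D + 1)) ℝ →ₗ[ℝ] Matrix (Fin (D + 1)) (Fin (D + 1)) ℝ :=
  ∑ k ∈ Finset.range (2 * j + 1), krausWeight j k •
    LinearMap.mulLeftRight ℝ (krausOp D j k, (krausOp D j k).transpose)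

theorem covariantMap_apply (D j : ℕ) (X : Matrix (Fin (D + 1)) (Fin (D + 1)) ℝ) :
    covariantMap D j X = ∑ k ∈ Finset.range (2 * j + 1),
      krausWeight j k • (krausOp D j k * X * (krausOp D j k).transpose) := by
  simp [covariantMap, LinearMap.sum_apply]

theorem transpose_covariantMap (X : Matrix (Fin (D + 1)) (Fin (D + 1)) ℝ) :
    (covariantMap D j X).transpose = covariantMap D j X.transpose := by
  simp [covariantMap_apply, Matrix.transpose_sum, Matrix.transpose_mul, mul_assoc]

theorem transpose_lie (A B : Matrix (Fin (D + 1)) (Fin (D + 1)) ℝ) :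
    ⁅A, B⁆.transpose = -⁅A.transpose, B.transpose⁆ := by
  simp [Ring.lie_def, Matrix.transpose_mul]

/-- The terms `⁅E, Sₖ⁆ X Sₖᵀ` and `Sₖ X ⁅E, Sₖᵀ⁆` cancel after a shift of the summation index,
which is what the choice of the weights achieves. -/
theorem raising_lie_covariantMap (hD : 0 < D) (hj : j ≤ D)
    (X : Matrix (Fin (D + 1)) (Fin (D + 1)) ℝ) :
    ⁅raising D, covariantMap D j X⁆ = covariantMap D j ⁅raising D, X⁆ := by
  have hT : ∀ k, ⁅raising D, (krausOp D j k).transpose⁆ = -(krausOp D j (k + 1)).transpose := by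
    intro k
    rw [← lowering_lie_krausOp, transpose_lie, neg_neg, lowering, Matrix.transpose_transpose]
  have hterm : ∀ k, ⁅raising D, krausWeight j k • (krausOp D j k * X * (krausOp D j k).transpose)⁆
      = krausWeight j k • (krausOp D j k * ⁅raising D, X⁆ * (krausOp D j k).transpose)
        + (krausWeight j k • (⁅raising D, krausOp D j k⁆ * X * (krausOp D j k).transpose)
          - krausWeight j k • (krausOp D j k * X * (krausOp D j (k + 1)).transpose)) := by
    intro k
    rw [← neg_neg (krausOp D j (k + 1)).transpose, ← hT]
    simp only [Ring.lie_def]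
    simp only [mul_smul_comm, smul_mul_assoc, ← smul_sub, ← smul_add]
    congr 1
    noncomm_ring
  have hcancel : ∑ k ∈ Finset.range (2 * j + 1),
      (krausWeight j k • (⁅raising D, krausOp D j k⁆ * X * (krausOp D j k).transpose)
        - krausWeight j k • (krausOp D j k * X * (krausOp D j (k + 1)).transpose)) = 0 := by
    rw [Finset.sum_sub_distrib, Finset.sum_range_succ', Finset.sum_range_succ (fun k =>
      krausWeight j k • (krausOp D j k * X * (krausOp D j (k + 1)).transpose)),
      krausOp_eq_zero hD hj, raising_lie_krausOp_zero]
    simp only [zero_mul, smul_zero, Matrix.transpose_zero, mul_zero, add_zero]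
    refine sub_eq_zero.mpr (Finset.sum_congr rfl fun k hk => ?_)
    rw [raising_lie_krausOp_succ hD hj, ← krausWeight_succ (Finset.mem_range.mp hk), smul_mul_assoc,
      smul_mul_assoc, smul_smul]
  rw [covariantMap_apply, covariantMap_apply, lie_sum, Finset.sum_congr rfl fun k _ => hterm k,
    Finset.sum_add_distrib, hcancel, add_zero]

theorem lowering_lie_covariantMap (hD : 0 < D) (hj : j ≤ D)
    (X : Matrix (Fin (D + 1)) (Fin (D + 1)) ℝ) :
    ⁅lowering D, covariantMap D j X⁆ = covariantMap D j ⁅lowering D, X⁆ := by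
  have h := congrArg Matrix.transpose (raising_lie_covariantMap hD hj X.transpose)
  rw [transpose_lie, transpose_covariantMap, transpose_covariantMap, transpose_lie,
    Matrix.transpose_transpose, map_neg, neg_inj] at h
  exact h

theorem weightOp_lie_covariantMap (hD : 0 < D) (hj : j ≤ D)
    (X : Matrix (Fin (D + 1)) (Fin (D + 1)) ℝ) :
    ⁅weightOp D, covariantMap D j X⁆ = covariantMap D j ⁅weightOp D, X⁆ := by
  rw [← raising_lie_lowering, lie_lie, lie_lie, map_sub]
  simp only [raising_lie_covariantMap hD hj, lowering_lie_covariantMap hD hj]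

theorem exists_covariantMap_raising_pow (hD : 0 < D) (hj : j ≤ D) {i : ℕ} (hi : i ≤ D) :
    ∃ a : ℝ, covariantMap D j (raising D ^ i) = a • raising D ^ i :=
  exists_eq_smul_raising_pow hi
    (by rw [raising_lie_covariantMap hD hj, lie_raising_pow, map_zero])
    (by rw [weightOp_lie_covariantMap hD hj, weightOp_lie_raising_pow, map_smul])

/-- The Casimir operator of the adjoint action has eigenvalue `j (j + 1)` on every `krausOp D j k`,
while that of the left and of the right multiplication is a scalar; what remains are the mixed
terms. -/
theorem casimir_krausOp (hD : 0 < D) (hj : j ≤ D) (k : ℕ) :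
    (2 : ℝ) • (raising D * krausOp D j k * lowering D)
      + (2 : ℝ) • (lowering D * krausOp D j k * raising D)
      + weightOp D * krausOp D j k * weightOp D
      = ((D : ℝ) * (D + 2) - 2 * j * (j + 1)) • krausOp D j k := by
  have hEF : ⁅raising D, ⁅lowering D, krausOp D j k⁆⁆
      = (((k : ℝ) + 1) * (2 * j - k)) • krausOp D j k := by
    rw [lowering_lie_krausOp, raising_lie_krausOp_succ hD hj]
  have hFE : ⁅lowering D, ⁅raising D, krausOp D j k⁆⁆
      = ((k : ℝ) * (2 * j - k + 1)) • krausOp D j k := by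
    rw [raising_lie_krausOp hD hj, lie_smul, lowering_lie_krausOp]
    rcases k with _ | k
    · simp
    · rfl
  have hHH : ⁅weightOp D, ⁅weightOp D, krausOp D j k⁆⁆
      = ((2 * j - 2 * k : ℝ) ^ 2) • krausOp D j k := by
    rw [weightOp_lie_krausOp hD hj, lie_smul, weightOp_lie_krausOp hD hj, smul_smul, sq]
  have hfe := lowering_mul_raising_eq (D := D)
  have hef : raising D * lowering D = lowering D * raising D + weightOp D := by
    rw [← raising_lie_lowering, Ring.lie_def]; abel
  generalize krausOp D j k = S at *
  have hl := congrArg (· * S) hfe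
  have hr := congrArg (S * ·) hfe
  have hl' := congrArg (· * S) hef
  have hr' := congrArg (S * ·) hef
  simp only [Ring.lie_def, mul_sub, sub_mul, mul_add, add_mul, smul_mul_assoc, mul_smul_comm,
    one_mul, mul_one, mul_assoc] at *
  linear_combination (norm := module) (-1 : ℝ) • hEF + (-1 : ℝ) • hFE + (-1 / 2 : ℝ) • hHH
    + (2 : ℝ) • hl + (2 : ℝ) • hr + hl' + hr'

theorem casimir_covariantMap (hD : 0 < D) (hj : j ≤ D)
    (X : Matrix (Fin (D + 1)) (Fin (D + 1)) ℝ) :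
    (2 : ℝ) • (raising D * covariantMap D j (lowering D * X))
      + (2 : ℝ) • (lowering D * covariantMap D j (raising D * X))
      + weightOp D * covariantMap D j (weightOp D * X)
      = ((D : ℝ) * (D + 2) - 2 * j * (j + 1)) • covariantMap D j X := by
  simp only [covariantMap_apply, Finset.mul_sum, Finset.smul_sum, ← Finset.sum_add_distrib]
  refine Finset.sum_congr rfl fun k _ => ?_
  have h := congrArg (fun Y => krausWeight j k • (Y * X * (krausOp D j k).transpose))
    (casimir_krausOp hD hj k)
  simp only [add_mul, smul_mul_assoc, mul_smul_comm, mul_assoc] at h ⊢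
  rw [smul_comm (_ - _) (krausWeight j k), ← h]
  module

/-! ### The recurrence for the eigenvalues -/

theorem lowering_lie_raising_pow_succ (n : ℕ) :
    ⁅lowering D, raising D ^ (n + 1)⁆
      = (-(n + 1) : ℝ) • (weightOp D * raising D ^ n - (n : ℝ) • raising D ^ n) := by
  have h1 : lowering D * raising D = raising D * lowering D - weightOp D := by
    rw [← raising_lie_lowering, Ring.lie_def]; abel
  have h2 := weightOp_mul_raising (D := D)
  induction n with
  | zero =>
    simp only [zero_add, pow_one, Ring.lie_def, h1, pow_zero, mul_one]
    push_cast
    module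
  | succ n ih =>
    have h3 := congrArg (raising D * ·) ih
    have h5 := congrArg (· * raising D ^ n) h2
    simp only [Ring.lie_def, mul_sub, add_mul, mul_smul_comm, smul_mul_assoc, mul_assoc,
      ← pow_succ'] at h3 h5 ⊢
    push_cast
    rw [pow_succ' _ (n + 1), ← mul_assoc, h1, sub_mul, mul_assoc]
    linear_combination (norm := skip) h3 + ((n : ℝ) + 1) • h5
    simp only [pow_succ', mul_assoc]
    module

theorem lowering_lie_weightOp : ⁅lowering D, weightOp D⁆ = (2 : ℝ) • lowering D := by
  rw [← lie_skew, weightOp_lie_lowering, neg_neg]; module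

/-- The expansion of `⁅F, ⁅F, E ^ (n + 2)⁆⁆` in the operators `Hᵏ E ^ n`. -/
theorem lowering_lie_lowering_lie_raising_pow (n : ℕ) :
    ⁅lowering D, ⁅lowering D, raising D ^ (n + 2)⁆⁆
      = (-(n + 2) : ℝ) • (((D : ℝ) * (D + 2) / 2 - n * (n + 1) ^ 2) • raising D ^ n
        + (((n : ℝ) + 1) * (2 * n + 1) - 1) • (weightOp D * raising D ^ n)
        - ((n : ℝ) + 3 / 2) • (weightOp D * (weightOp D * raising D ^ n))) := by
  have h2 := lowering_lie_raising_pow_succ (D := D) n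
  have h4 := congrArg (· * raising D ^ n) (lowering_mul_raising_eq (D := D))
  have h6 : ⁅lowering D, weightOp D * raising D ^ (n + 1)⁆
      = ⁅lowering D, weightOp D⁆ * raising D ^ (n + 1)
        + weightOp D * ⁅lowering D, raising D ^ (n + 1)⁆ := by
    simp only [Ring.lie_def]; noncomm_ring
  rw [lowering_lie_raising_pow_succ (n + 1), lie_smul, lie_sub, lie_smul, h6, lowering_lie_weightOp, h2]
  simp only [mul_sub, sub_mul, mul_smul_comm, smul_mul_assoc, mul_assoc, one_mul,
    ← pow_succ'] at h4 ⊢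
  rw [h4]
  push_cast
  module

section Eigenvalues

variable {l : ℕ → ℝ} (hl : ∀ i, i ≤ D → covariantMap D j (raising D ^ i) = l i • raising D ^ i)

include hl

/-- `H E ^ n` is a combination of `E ^ n` and `⁅F, E ^ (n + 1)⁆`, which lie in the components of
spins `n` and `n + 1`. -/
theorem covariantMap_weightOp_mul_raising_pow (hD : 0 < D) (hj : j ≤ D) {n : ℕ} (hn : n + 1 ≤ D) :
    covariantMap D j (weightOp D * raising D ^ n)
      = ((n : ℝ) * (l n - l (n + 1))) • raising D ^ n
        + l (n + 1) • (weightOp D * raising D ^ n) := by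
  have h := lowering_lie_covariantMap hD hj (raising D ^ (n + 1))
  rw [hl _ hn, lie_smul, lowering_lie_raising_pow_succ, map_smul, map_sub, map_smul,
    hl n (by omega), smul_comm] at h
  have h' := smul_right_injective _ (show (-(n + 1) : ℝ) ≠ 0 by
    rw [neg_ne_zero]; positivity) h
  linear_combination (norm := module) -h'

/-- The Casimir identity at `X = E ^ (n + 1)`. The image of `F X` comes from those of `E ^ n`,
`H E ^ n` and `H ^ 2 E ^ n`, of which the last is obtained from `⁅F, ⁅F, E ^ (n + 2)⁆⁆`. -/
theorem covariantMap_eigenvalue_recurrence (hD : 0 < D) (hj : j ≤ D) {n : ℕ} (hn : n + 2 ≤ D) :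
    theta D j * l (n + 1) = coeffB D (n + 1) * l (n + 2) + coeffA D (n + 1) * l (n + 1)
        + coeffC D (n + 1) * l n := by
  have hD' : (0 : ℝ) < D := by exact_mod_cast hD
  have hg := hl n (by omega)
  have he := hl (n + 1) (by omega)
  have hee := hl (n + 2) hn
  have hHg := covariantMap_weightOp_mul_raising_pow hl hD hj (show n + 1 ≤ D by omega)
  have hHe := covariantMap_weightOp_mul_raising_pow hl hD hj hn
  have hHHg : (((D : ℝ) * (D + 2) / 2 - n * (n + 1) ^ 2) * l n) • raising D ^ n
        + (((n : ℝ) + 1) * (2 * n + 1) - 1) • covariantMap D j (weightOp D * raising D ^ n)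
        - ((n : ℝ) + 3 / 2) • covariantMap D j (weightOp D * (weightOp D * raising D ^ n))
      = l (n + 2) • (((D : ℝ) * (D + 2) / 2 - n * (n + 1) ^ 2) • raising D ^ n
        + (((n : ℝ) + 1) * (2 * n + 1) - 1) • (weightOp D * raising D ^ n)
        - ((n : ℝ) + 3 / 2) • (weightOp D * (weightOp D * raising D ^ n))) := by
    have h := lowering_lie_covariantMap hD hj ⁅lowering D, raising D ^ (n + 2)⁆
    rw [← lowering_lie_covariantMap hD hj, hee, lie_smul, lie_smul,
      lowering_lie_lowering_lie_raising_pow, map_smul, smul_comm] at h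
    have h' := smul_right_injective _ (show (-(n + 2) : ℝ) ≠ 0 by
      rw [neg_ne_zero]; positivity) h
    simp only [map_sub, map_add, map_smul, hg] at h'
    linear_combination (norm := module) -h'
  have hEH : raising D * (weightOp D * raising D ^ n)
      = weightOp D * raising D ^ (n + 1) - (2 : ℝ) • raising D ^ (n + 1) := by
    rw [← mul_assoc, eq_sub_of_add_eq (weightOp_mul_raising (D := D)).symm, sub_mul, mul_assoc,
      smul_mul_assoc, ← pow_succ']
  have hEHH : raising D * (weightOp D * (weightOp D * raising D ^ n))
      = weightOp D * (weightOp D * raising D ^ (n + 1))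
        - (4 : ℝ) • (weightOp D * raising D ^ (n + 1)) + (4 : ℝ) • raising D ^ (n + 1) := by
    rw [← mul_assoc, eq_sub_of_add_eq (weightOp_mul_raising (D := D)).symm, sub_mul, mul_assoc,
      smul_mul_assoc, hEH, mul_sub, mul_smul_comm]
    module
  have hFE : ∀ m, lowering D * raising D ^ (m + 1)
      = (1 / 4 : ℝ) • (((D : ℝ) * (D + 2)) • raising D ^ m
        - (2 : ℝ) • (weightOp D * raising D ^ m)
        - weightOp D * (weightOp D * raising D ^ m)) := by
    intro m
    rw [pow_succ', ← mul_assoc, lowering_mul_raising_eq]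
    simp only [smul_mul_assoc, sub_mul, one_mul, mul_assoc]
  have hC := casimir_covariantMap hD hj (raising D ^ (n + 1))
  have hR := congrArg (raising D * ·) hHHg
  rw [hFE, ← pow_succ' _ (n + 1), hee, he, hHe, mul_smul_comm (l (n + 1 + 1)), hFE] at hC
  simp only [map_smul, map_sub, hg, hHg, mul_add, mul_sub, mul_smul_comm, ← pow_succ', hEH,
    hEHH] at hC hR
  -- Multiplying by `2 n + 3` lets `hR` eliminate the image of `H ^ 2 E ^ n`.
  have hfin : ((2 * n + 3) * ((D : ℝ) * (D + 2) - 2 * j * (j + 1)) * l (n + 1))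
        • raising D ^ (n + 1)
      = (((D : ℝ) - (n + 1)) * (n + 2) * (D + n + 3) * l (n + 2)
        + (n + 1) * (n + 2) * (2 * n + 3) * l (n + 1)
        + (D - n) * (n + 1) * (D + n + 2) * l n) • raising D ^ (n + 1) := by
    push_cast at hC
    linear_combination (norm := module) -(2 * n + 3 : ℝ) • hC + hR
  have hs := smul_left_injective ℝ (raising_pow_ne_zero (show n + 1 ≤ D by omega)) hfin
  simp only [theta, coeffA, coeffB, coeffC]
  push_cast
  field_simp
  linear_combination hs

/-- The Casimir identity at `X = 1`. -/
theorem covariantMap_eigenvalue_one (hD : 0 < D) (hj : j ≤ D) :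
    l 1 = l 0 * (theta D j / 3) := by
  have hD' : (0 : ℝ) < D := by exact_mod_cast hD
  have h0 := hl 0 (by omega)
  have h1 := hl 1 hD
  have hH := covariantMap_weightOp_mul_raising_pow hl hD hj (n := 0) (by omega)
  have hF : covariantMap D j (lowering D) = l 1 • lowering D := by
    have h := lowering_lie_covariantMap hD hj (weightOp D)
    simp only [pow_zero, mul_one, Nat.cast_zero, zero_mul, zero_smul, zero_add] at hH
    rw [hH, lie_smul, lowering_lie_weightOp, map_smul, smul_comm] at h
    exact (smul_right_injective _ (two_ne_zero (α := ℝ)) h).symm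
  have hC := casimir_covariantMap hD hj (raising D ^ 0)
  have hfe := lowering_mul_raising_eq (D := D)
  have hef : raising D * lowering D = lowering D * raising D + weightOp D := by
    rw [← raising_lie_lowering, Ring.lie_def]; abel
  simp only [pow_zero, pow_one, mul_one, Nat.cast_zero, zero_mul, zero_smul, zero_add] at h0 h1 hH hC
  rw [hF, h1, hH, h0, mul_smul_comm, mul_smul_comm, mul_smul_comm, hef, hfe] at hC
  have hs : (l 1 * (D * (D + 2))) • (1 : Matrix (Fin (D + 1)) (Fin (D + 1)) ℝ)
      = (((D : ℝ) * (D + 2) - 2 * j * (j + 1)) * l 0) • 1 := by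
    linear_combination (norm := module) hC
  have hs' := smul_left_injective ℝ one_ne_zero hs
  simp only [theta, coeffA]
  field_simp
  linear_combination hs'

theorem covariantMap_eigenvalue_eq (hD : 0 < D) (hj : j ≤ D) {i : ℕ} (hi : i ≤ D) :
    l i = l 0 * (racahU D i).eval (theta D j) :=
  racahU_eval_unique rfl (covariantMap_eigenvalue_one hl hD hj)
    (fun _ hn => covariantMap_eigenvalue_recurrence hl hD hj hn) i hi

theorem covariantMap_eigenvalue_zero_pos (hj : j ≤ D) : 0 < l 0 := by
  let p : Fin (D + 1) := ⟨j, Nat.lt_succ_of_le hj⟩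
  have h := congrFun₂ (hl 0 (by omega)) p p
  rw [pow_zero, Matrix.smul_apply, Matrix.one_apply_eq, smul_eq_mul, mul_one,
    covariantMap_apply, Matrix.sum_apply] at h
  rw [← h]
  have hterm : ∀ k, (krausWeight j k • (krausOp D j k * 1 * (krausOp D j k).transpose) :
      Matrix (Fin (D + 1)) (Fin (D + 1)) ℝ) p p = krausWeight j k * ∑ y, krausOp D j k p y ^ 2 := fun k => by
    simp [Matrix.mul_apply, sq]
  refine Finset.sum_pos' (fun k _ => ?_) ⟨0, by simp, ?_⟩
  · rw [hterm]
    exact mul_nonneg (krausWeight_pos j k).le (Finset.sum_nonneg fun _ _ => sq_nonneg _)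
  · rw [hterm]
    exact mul_pos (krausWeight_pos j 0) <| Finset.sum_pos' (fun _ _ => sq_nonneg _)
      ⟨0, Finset.mem_univ _, pow_pos (raising_pow_apply_pos hj) 2⟩

theorem abs_covariantMap_eigenvalue_le (hj : j ≤ D) {i : ℕ} (hi : i ≤ D) : |l i| ≤ l 0 := by
  refine abs_le_of_kraus_eigenmatrix (Finset.range (2 * j + 1)) (krausWeight j)
    (fun k _ => (krausWeight_pos j k).le) (krausOp D j) (raising D ^ i) (raising_pow_ne_zero hi)
    (covariantMap_eigenvalue_zero_pos hl hj).le ?_ ?_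
  · have h := hl 0 (by omega)
    simpa only [covariantMap_apply, pow_zero, mul_one] using h
  · rw [← covariantMap_apply, hl i hi]

end Eigenvalues

theorem abs_racahU_eval_theta_le_one {i : ℕ} (hD : 0 < D) (hi : i ≤ D) (hj : j ≤ D) :
    |(racahU D i).eval (theta D j)| ≤ 1 := by
  have h : ∀ i : ℕ, ∃ a : ℝ, i ≤ D → covariantMap D j (raising D ^ i) = a • raising D ^ i := by
    intro i
    by_cases hi : i ≤ D
    · exact (exists_covariantMap_raising_pow hD hj hi).imp fun _ ha _ => ha
    · exact ⟨0, fun h => absurd h hi⟩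
  choose l hl using h
  have h0 := covariantMap_eigenvalue_zero_pos hl hj
  have hle := abs_covariantMap_eigenvalue_le hl hj hi
  rw [covariantMap_eigenvalue_eq hl hD hj hi, abs_mul, abs_of_pos h0] at hle
  exact (mul_le_iff_le_one_right h0).mp hle

end

end KreschTamvakis

theorem theorem1p3 (D : ℕ) (hD : 0 < D) (i j : ℕ) (hi : i ≤ D) (hj : j ≤ D) :
    Summable (KreschTamvakis.hyp4F3Term
        (-(i : ℝ)) ((i : ℝ) + 1) (-(j : ℝ)) ((j : ℝ) + 1) 1 ((D : ℝ) + 2) (-(D : ℝ)) 1) ∧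
      |KreschTamvakis.hyp4F3
        (-(i : ℝ)) ((i : ℝ) + 1) (-(j : ℝ)) ((j : ℝ) + 1) 1 ((D : ℝ) + 2) (-(D : ℝ)) 1| ≤ 1 ∧
      (KreschTamvakis.racahU D i).eval (KreschTamvakis.theta D j) =
        KreschTamvakis.hyp4F3
          (-(i : ℝ)) ((i : ℝ) + 1) (-(j : ℝ)) ((j : ℝ) + 1) 1 ((D : ℝ) + 2) (-(D : ℝ)) 1 ∧
      |(KreschTamvakis.racahU D i).eval (KreschTamvakis.theta D j)| ≤ 1 := by
  have hsum := KreschTamvakis.hasSum_hyp4F3Term hj i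
  have heq : (KreschTamvakis.racahU D i).eval (KreschTamvakis.theta D j) =
      KreschTamvakis.hyp4F3
        (-(i : ℝ)) ((i : ℝ) + 1) (-(j : ℝ)) ((j : ℝ) + 1) 1 ((D : ℝ) + 2) (-(D : ℝ)) 1 :=
    (KreschTamvakis.racahU_eval_theta_eq_hypSum hD hi hj).trans hsum.tsum_eq.symm
  have hle := KreschTamvakis.abs_racahU_eval_theta_le_one hD hi hj
  exact ⟨hsum.summable, heq ▸ hle, heq, hle⟩
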